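/- Let $d,K,N,M$ be positive integers with $M\le K$. Let $$P(\mathbf x)=\sum_{\mathbf k\in(\mathbb Z\cap[-K,K])^d}c_{\mathbf k}\,e^{2\pi i\,\mathbf k\cdot\mathbf x/N},\qquad \mathbf x\in\mathbb R^d,$$ be a real-valued trigonometric polynomial such that, for every $\mathbf k\in(N\mathbb Z)^d\cap[-K,K]^d$, $c_{\mathbf k}=N^{-d}$ if $\mathbf k=\mathbf 0$ and $c_{\mathbf k}=0$ if $\mathbf k\neq\mathbf 0$. Assume that $P\chi_{[0,N]^d}\in C^{2M-1}(\mathbb R^d)$ and that $$P(\mathbf x)=\Big(\prod_{j=1}^d\sin^{2M}(\pi x_j/N)\Big)G(\mathbf x)H(\mathbf x),\qquad \mathbf x\in\mathbb R^d,$$ where $G$ and $H$ are real-valued $(N\mathbb Z)^d$-periodic trigonometric polynomials, i.e. finite sums of the form $\sum_{\mathbf k\in\mathbb Z^d}a_{\mathbf k}e^{2\pi i\,\mathbf k\cdot\mathbf x/N}$ with complex coefficients. Let $B$ be a real invertible $d\times d$ matrix and put $B^\sharp=(B^T)^{-1}$. Assume that $B^\sharp\mathbf n\notin(-N,N)^d$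 for all $\mathbf n\in\mathbb Z^d\setminus\{\mathbf 0\}$. Define $$g(\mathbf x)=\Big(\prod_{j=1}^d\sin^{M}(\pi x_j/N)\Big)G(\mathbf x)\,\chi_{[0,N]^d}(\mathbf x),\qquad h(\mathbf x)=|\det B|\Big(\prod_{j=1}^d\sin^{M}(\pi x_j/N)\Big)H(\mathbf x)\,\chi_{[0,N]^d}(\mathbf x).$$ Then $g,h\in C^{M-1}(\mathbb R^d)$, and the Gabor systems $\{E_{B\mathbf m}T_{\mathbf n}g\}_{\mathbf m,\mathbf n\in\mathbb Z^d}$ and $\{E_{B\mathbf m}T_{\mathbf n}h\}_{\mathbf m,\mathbf n\in\mathbb Z^d}$, where $(T_{\mathbf y}f)(\mathbf x)=f(\mathbf x-\mathbf y)$ and $(E_{\mathbf y}f)(\mathbf x)=e^{2\pi i\,\mathbf y\cdot\mathbf x}f(\mathbf x)$, are dual frames for $L^2(\mathbb R^d)$. That is, each of the two systems $(f_{\mathbf m,\mathbf n})$ satisfies $a\|f\|^2\le\sum_{\mathbf m,\mathbf n}|\langle f,f_{\mathbf m,\mathbf n}\rangle|^2\le b\|f\|^2$ for all $f\in L^2(\mathbb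 R^d)$ with some constants $0<a\le b<\infty$, and $$f=\sum_{\mathbf m,\mathbf n\in\mathbb Z^d}\langle f,E_{B\mathbf m}T_{\mathbf n}g\rangle\,E_{B\mathbf m}T_{\mathbf n}h=\sum_{\mathbf m,\mathbf n\in\mathbb Z^d}\langle f,E_{B\mathbf m}T_{\mathbf n}h\rangle\,E_{B\mathbf m}T_{\mathbf n}g\qquad\text{for all } f\in L^2(\mathbb R^d),$$ with unconditional convergence in $L^2(\mathbb R^d)$. -/

import Mathlib

open MeasureTheory

noncomputable section

/-- The cube `[0,N]^d` in `ℝ^d`. -/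
def cube (d N : ℕ) : Set (EuclideanSpace ℝ (Fin d)) :=
  {x | ∀ j, x j ∈ Set.Icc (0 : ℝ) (N : ℝ)}

/-- The frequency box `(ℤ ∩ [-K,K])^d`. -/
def freqBox (d K : ℕ) : Finset (Fin d → ℤ) :=
  Fintype.piFinset fun _ => Finset.Icc (-(K : ℤ)) (K : ℤ)

/-- The `(Nℤ)^d`-periodic trigonometric polynomial `x ↦ ∑_{k ∈ S} c_k e^{2πi k·x/N}`. -/
def trigPoly {d : ℕ} (N : ℕ) (S : Finset (Fin d → ℤ)) (c : (Fin d → ℤ) → ℂ)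
    (x : EuclideanSpace ℝ (Fin d)) : ℂ :=
  ∑ k ∈ S, c k * Complex.exp (2 * Real.pi * Complex.I * (∑ j, (k j : ℂ) * (x j : ℂ)) / N)

/-- A real-valued function that is an `(Nℤ)^d`-periodic trigonometric polynomial. -/
def IsRealTrigPoly {d : ℕ} (N : ℕ) (G : EuclideanSpace ℝ (Fin d) → ℝ) : Prop :=
  ∃ (S : Finset (Fin d → ℤ)) (c : (Fin d → ℤ) → ℂ), ∀ x, (G x : ℂ) = trigPoly N S c x

/-- The window `(∏_j sin^M(π x_j / N)) G(x) χ_{[0,N]^d}(x)`. -/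
def sinWindow {d : ℕ} (M N : ℕ) (G : EuclideanSpace ℝ (Fin d) → ℝ) :
    EuclideanSpace ℝ (Fin d) → ℂ :=
  (cube d N).indicator fun x => (((∏ j, Real.sin (Real.pi * x j / N) ^ M) * G x : ℝ) : ℂ)

/-- Translation `(T_y f)(x) = f (x - y)`. -/
def translateFn {d : ℕ} (y : EuclideanSpace ℝ (Fin d)) (f : EuclideanSpace ℝ (Fin d) → ℂ) :
    EuclideanSpace ℝ (Fin d) → ℂ :=
  fun x => f (x - y)

/-- Modulation `(E_y f)(x) = e^{2πi y·x} f(x)`. -/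
def modulateFn {d : ℕ} (y : EuclideanSpace ℝ (Fin d)) (f : EuclideanSpace ℝ (Fin d) → ℂ) :
    EuclideanSpace ℝ (Fin d) → ℂ :=
  fun x => Complex.exp (2 * Real.pi * Complex.I * (inner ℝ y x : ℝ)) * f x

/-- An integer vector regarded as a real vector. -/
def intVec {d : ℕ} (n : Fin d → ℤ) : Fin d → ℝ := fun j => (n j : ℝ)

/-- The Gabor system `{E_{Bm} T_n g}`, indexed by `(m, n) ∈ ℤ^d × ℤ^d`. -/
def gaborSystem {d : ℕ} (B : Matrix (Fin d) (Fin d) ℝ) (g : EuclideanSpace ℝ (Fin d) → ℂ)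
    (p : (Fin d → ℤ) × (Fin d → ℤ)) : EuclideanSpace ℝ (Fin d) → ℂ :=
  modulateFn (WithLp.toLp 2 (B.mulVec (intVec p.1))) (translateFn (WithLp.toLp 2 (intVec p.2)) g)

/-- `(F i)` is a frame for the Hilbert space `H`: for some `0 < a` and `b`,
`a ‖f‖² ≤ ∑ |⟨f, F i⟩|² ≤ b ‖f‖²` for all `f`. -/
def IsFrame {ι H : Type*} [NormedAddCommGroup H] [InnerProductSpace ℂ H] (F : ι → H) : Prop :=
  ∃ a b : ℝ, 0 < a ∧ 0 < b ∧ ∀ f : H,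
    Summable (fun i => ‖inner ℂ (F i) f‖ ^ 2) ∧
    a * ‖f‖ ^ 2 ≤ ∑' i, ‖inner ℂ (F i) f‖ ^ 2 ∧
    ∑' i, ‖inner ℂ (F i) f‖ ^ 2 ≤ b * ‖f‖ ^ 2

/-- Two frames are dual: `f = ∑ ⟨f, F i⟩ F' i = ∑ ⟨f, F' i⟩ F i` for all `f`.
(Mathlib's `inner` is linear in its second argument.) -/
def IsDualFramePair {ι H : Type*} [NormedAddCommGroup H] [InnerProductSpace ℂ H]
    (F F' : ι → H) : Prop :=
  IsFrame F ∧ IsFrame F' ∧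
    (∀ f : H, HasSum (fun i => inner ℂ (F i) f • F' i) f) ∧
    (∀ f : H, HasSum (fun i => inner ℂ (F' i) f • F i) f)

/-- The Gabor systems `{E_{Bm} T_n g}` and `{E_{Bm} T_n h}` consist of `L²` functions and
are dual frames for `L²(ℝ^d)`. -/
def GenerateDualGaborFrames {d : ℕ} (B : Matrix (Fin d) (Fin d) ℝ)
    (g h : EuclideanSpace ℝ (Fin d) → ℂ) : Prop :=
  ∃ (hg : ∀ p, MemLp (gaborSystem B g p) 2 volume)
    (hh : ∀ p, MemLp (gaborSystem B h p) 2 volume),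
    IsDualFramePair (H := Lp ℂ 2 (volume : Measure (EuclideanSpace ℝ (Fin d))))
      (fun p => (hg p).toLp) (fun p => (hh p).toLp)

end

/-! The sine factors vanish on the faces of the cube, so both windows live on `[0,N)^d`. Fix `n`.
Two points of `Q = n + [0,N)^d` differ by an element of `(-N,N)^d`, hence never by a nonzero vector
of `B^♯ ℤ^d`. So `x ↦ Bᵀ x` embeds `Q` in the torus, and Parseval there
(`hasSum_integral_exp_of_packing`) evaluates the sum over `m` of `⟨u, E_{Bm} T_n h⟩ ⟨f, E_{Bm} T_n
g⟩` as `|det B|⁻¹ ∫ g(x-n) h(x-n) f(x) conj (u x)` for the real windows at hand. A packing is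
enough: functions on `Q` are extended by zero to the rest of the torus.

Summing over `n`, duality becomes `∑ₙ g(x-n) h(x-n) = |det B|`. On the cube `g h = |det B| P`, and
the points `x - n` in the cube are `fract x + r` with `r ∈ {0,…,N-1}^d`. Summing `P` over these
`N^d` points kills every frequency outside `(Nℤ)^d`; the coefficient hypothesis leaves `N^d c₀ = 1`.

The same Parseval formula with `h = g` and `u = f` gives Bessel bounds, since boundedly many
translates overlap. Two Bessel families reproducing inner products weakly are dual frames
(`isDualFramePair_of_bessel`). Smoothness is separate: `sin^M` vanishes to order `M` at the ends of
`[0,N]`. -/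

/-! ### Parseval's identity on sets that embed in the torus. -/

noncomputable section TorusParseval

open scoped ComplexConjugate

/-- The probability Haar measure on `ℝ / ℤ`, as in the theory of `UnitAddTorus`. -/
local instance unitAddCircleMeasureSpace : MeasureSpace UnitAddCircle :=
  ⟨AddCircle.haarAddCircle⟩

/-- The covering map `ℝ^d → (ℝ / ℤ)^d`. -/
def torusMk {d : ℕ} (y : Fin d → ℝ) : UnitAddTorus (Fin d) := fun i => (y i : UnitAddCircle)

theorem continuous_torusMk {d : ℕ} : Continuous (torusMk (d := d)) :=
  continuous_pi fun i => (AddCircle.continuous_mk' 1).comp (continuous_apply i)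

theorem torusMk_eq_iff {d : ℕ} {x y : Fin d → ℝ} :
    torusMk x = torusMk y ↔ ∃ k : Fin d → ℤ, y + intVec k = x := by
  constructor
  · intro h
    have : ∀ i, ∃ k : ℤ, y i + k = x i := by
      intro i
      have hi := sub_eq_zero.2 (congrFun h i)
      simp only [torusMk, ← AddCircle.coe_sub] at hi
      obtain ⟨k, hk⟩ := (AddCircle.coe_eq_zero_iff (1 : ℝ)).1 hi
      refine ⟨k, ?_⟩
      simp only [zsmul_eq_mul, mul_one] at hk
      linarith
    choose k hk using this
    exact ⟨k, funext hk⟩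
  · rintro ⟨k, rfl⟩
    funext i
    simp [torusMk, intVec]

theorem volume_torus_eq {d : ℕ} {S : Set (UnitAddTorus (Fin d))} (hS : MeasurableSet S) :
    volume S = volume ({y : Fin d → ℝ | ∀ i, y i ∈ Set.Ioc (0 : ℝ) 1} ∩ torusMk ⁻¹' S) := by
  have h := UnitAddTorus.lintegral_preimage (S.indicator 1) (fun _ : Fin d => (0 : ℝ))
  have hF : MeasurableSet {y : Fin d → ℝ | ∀ i, y i ∈ Set.Ioc (0 : ℝ) 1} :=
    MeasurableSet.univ_pi' fun _ => measurableSet_Ioc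
  have h2 : MeasurableSet (torusMk ⁻¹' S) := continuous_torusMk.measurable hS
  rw [lintegral_indicator_one hS] at h
  rw [h]
  simp only [zero_add]
  rw [show (fun x : Fin d → ℝ => S.indicator (1 : UnitAddTorus (Fin d) → ENNReal)
    (fun i => (x i : UnitAddCircle))) = (torusMk ⁻¹' S).indicator 1 from rfl,
    lintegral_indicator_one h2, Measure.restrict_apply h2, Set.inter_comm]

/-- A measurable set that meets each coset of `ℤ^d` at most once has the same volume as its
image in the torus. -/
theorem volume_torusMk_image {d : ℕ} {A : Set (Fin d → ℝ)} (hA : MeasurableSet A)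
    (hinj : Set.InjOn torusMk A) : volume (torusMk '' A) = volume A := by
  have himg : MeasurableSet (torusMk '' A) :=
    hA.image_of_continuousOn_injOn continuous_torusMk.continuousOn hinj
  rw [volume_torus_eq himg]
  set F : Set (Fin d → ℝ) := {y | ∀ i, y i ∈ Set.Ioc (0 : ℝ) 1} with hFdef
  have hF : MeasurableSet F := MeasurableSet.univ_pi' fun _ => measurableSet_Ioc
  have hadd : ∀ k : Fin d → ℤ, Measurable fun y : Fin d → ℝ => y + intVec k :=
    fun k => measurable_id.add_const _
  have hsub : ∀ k : Fin d → ℤ, Measurable fun y : Fin d → ℝ => y - intVec k :=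
    fun k => measurable_id.sub_const _
  have hinv : Function.Injective (intVec (d := d)) := by
    intro a b h
    funext i
    have := congrFun h i
    simpa [intVec] using this
  -- Both sets are cut into pieces indexed by `k`: `F ∩ (A - k)` here and `A ∩ (F + k)` in `h2`.
  -- Translation by `k` matches the pieces. Disjointness comes from `hinj` for the former and from
  -- `F` being a half-open unit cube for the latter.
  have h1 : F ∩ torusMk ⁻¹' (torusMk '' A)
      = ⋃ k : Fin d → ℤ, F ∩ (fun y => y + intVec k) ⁻¹' A := by
    ext y
    simp only [Set.mem_inter_iff, Set.mem_preimage, Set.mem_image, Set.mem_iUnion,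
      exists_and_left, and_congr_right_iff]
    intro _
    constructor
    · rintro ⟨x, hx, hxy⟩
      obtain ⟨k, hk⟩ := torusMk_eq_iff.1 hxy
      exact ⟨k, by rwa [hk]⟩
    · rintro ⟨k, hk⟩
      exact ⟨_, hk, torusMk_eq_iff.2 ⟨k, rfl⟩⟩
  have h2 : A = ⋃ k : Fin d → ℤ, A ∩ (fun y => y - intVec k) ⁻¹' F := by
    rw [← Set.inter_iUnion, eq_comm, Set.inter_eq_left]
    intro y _
    -- `F` is open on the left and closed on the right, hence `⌈y⌉ - 1` in place of the floor.
    refine Set.mem_iUnion.2 ⟨fun i => ⌈y i⌉ - 1, fun i => ?_⟩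
    have := Int.ceil_lt_add_one (y i)
    have := Int.le_ceil (y i)
    simp only [intVec, Pi.sub_apply, Set.mem_Ioc]
    push_cast
    constructor <;> linarith
  rw [h1, measure_iUnion]
  · conv_rhs => rw [h2]
    rw [measure_iUnion]
    · congr 1
      funext k
      rw [← measure_preimage_add_right volume (intVec k) (A ∩ _)]
      congr 1
      ext y
      simp [and_comm]
    · intro k l hkl
      refine Set.disjoint_left.2 fun y hy hy' => hkl ?_
      funext i
      have a := hy.2 i
      have b := hy'.2 i
      simp only [intVec, Pi.sub_apply, Set.mem_Ioc] at a b
      have e1 : ((k i - l i : ℤ) : ℝ) < 1 := by push_cast; linarith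
      have e2 : ((l i - k i : ℤ) : ℝ) < 1 := by push_cast; linarith
      have e1 : k i - l i < 1 := by exact_mod_cast e1
      have e2 : l i - k i < 1 := by exact_mod_cast e2
      omega
    · exact fun k => hA.inter (hsub k hF)
  · intro k l hkl
    refine Set.disjoint_left.2 fun y hy hy' => hkl (hinv ?_)
    have : torusMk (y + intVec k) = torusMk (y + intVec l) :=
      (torusMk_eq_iff.2 ⟨k, rfl⟩).trans (torusMk_eq_iff.2 ⟨l, rfl⟩).symm
    exact add_left_cancel (hinj hy.2 hy'.2 this)
  · exact fun k => hF.inter (hadd k hA)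

/-- A measurable set meeting each coset of `ℤ^d` at most once carries the Parseval identity for
the exponentials of the torus: here `X` is a standard Borel space with an embedding `ι` into the
torus. -/
theorem hasSum_mFourier_of_measurableEmbedding {d : ℕ} {X : Type*} [MeasurableSpace X]
    {ι : X → UnitAddTorus (Fin d)} (hι : MeasurableEmbedding ι) {u v : X → ℂ}
    (hu : MemLp u 2 (Measure.comap ι volume)) (hv : MemLp v 2 (Measure.comap ι volume)) :
    HasSum (fun m : Fin d → ℤ =>
      conj (∫ x, UnitAddTorus.mFourier (-m) (ι x) * u x ∂(Measure.comap ι volume)) *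
        ∫ x, UnitAddTorus.mFourier (-m) (ι x) * v x ∂(Measure.comap ι volume))
      (∫ x, conj (u x) * v x ∂(Measure.comap ι volume)) := by
  have key : ∀ f : UnitAddTorus (Fin d) → ℂ, (∀ t ∉ Set.range ι, f t = 0) →
      ∫ t, f t = ∫ x, f (ι x) ∂(Measure.comap ι volume) := by
    intro f hf
    rw [← hι.integral_map, hι.map_comap, setIntegral_eq_integral_of_forall_compl_eq_zero hf]
  have ext0 : ∀ w : X → ℂ, ∀ t ∉ Set.range ι, Function.extend ι w 0 t = 0 := by
    intro w t ht
    rw [Function.extend_apply' _ _ _ ht]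
    rfl
  have extι : ∀ (w : X → ℂ) x, Function.extend ι w 0 (ι x) = w x :=
    fun w x => hι.injective.extend_apply _ _ _
  have mem : ∀ w : X → ℂ, MemLp w 2 (Measure.comap ι volume) →
      MemLp (Function.extend ι w 0) 2 (volume : Measure (UnitAddTorus (Fin d))) := by
    intro w hw
    have h : (Set.range ι).indicator (Function.extend ι w 0) = Function.extend ι w 0 :=
      Set.indicator_eq_self.2 fun t ht => by_contra fun h => ht (ext0 w t h)
    rw [← h, memLp_indicator_iff_restrict hι.measurableSet_range, ← hι.map_comap,
      hι.memLp_map_measure_iff]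
    exact (memLp_congr_ae (Filter.Eventually.of_forall fun x => extι w x)).2 hw
  have h := UnitAddTorus.hasSum_prod_mFourierCoeff (mem u hu).toLp (mem v hv).toLp
  have hcoef : ∀ (w : X → ℂ) (hw : MemLp w 2 (Measure.comap ι volume)) (m : Fin d → ℤ),
      UnitAddTorus.mFourierCoeff ((mem w hw).toLp) m
        = ∫ x, UnitAddTorus.mFourier (-m) (ι x) * w x ∂(Measure.comap ι volume) := by
    intro w hw m
    rw [UnitAddTorus.mFourierCoeff]
    rw [integral_congr_ae (g := fun t => UnitAddTorus.mFourier (-m) t * Function.extend ι w 0 t)]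
    · rw [key]
      · simp only [extι]
      · intro t ht
        rw [ext0 w t ht, mul_zero]
    · filter_upwards [(mem w hw).coeFn_toLp] with t ht
      rw [ht, smul_eq_mul]
  rw [funext fun m => congrArg₂ (fun a b => conj a * b) (hcoef u hu m).symm (hcoef v hv m).symm]
  convert h using 1
  symm
  rw [integral_congr_ae (g := fun t => conj (Function.extend ι u 0 t) * Function.extend ι v 0 t)]
  · rw [key]
    · simp only [extι]
    · intro t ht
      rw [ext0 v t ht, mul_zero]
  · filter_upwards [(mem u hu).coeFn_toLp, (mem v hv).coeFn_toLp] with t ht ht'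
    rw [ht, ht']

/-- Parseval's identity for the exponentials `exp (-2πi (B m)·x)` on a measurable set `Q` no two
of whose points differ by a nonzero vector of the lattice `(Bᵀ)⁻¹ ℤ^d`. -/
theorem hasSum_integral_exp_of_packing {d : ℕ} {B : Matrix (Fin d) (Fin d) ℝ} (hB : IsUnit B)
    {Q : Set (EuclideanSpace ℝ (Fin d))} (hQ : MeasurableSet Q)
    (hpack : ∀ x ∈ Q, ∀ y ∈ Q, ∀ n : Fin d → ℤ,
      (B.transpose⁻¹).mulVec (intVec n) = (x - y).ofLp → n = 0)
    {u v : EuclideanSpace ℝ (Fin d) → ℂ} (hu : MemLp u 2 (volume.restrict Q))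
    (hv : MemLp v 2 (volume.restrict Q)) :
    HasSum (fun m : Fin d → ℤ =>
      conj (∫ x in Q, Complex.exp (-(2 * Real.pi * Complex.I *
        (inner ℝ (WithLp.toLp 2 (B.mulVec (intVec m))) x : ℝ))) * u x) *
        ∫ x in Q, Complex.exp (-(2 * Real.pi * Complex.I *
        (inner ℝ (WithLp.toLp 2 (B.mulVec (intVec m))) x : ℝ))) * v x)
      (((|B.det|⁻¹ : ℝ) : ℂ) * ∫ x in Q, conj (u x) * v x) := by
  have hdet : B.det ≠ 0 := ((Matrix.isUnit_iff_isUnit_det B).1 hB).ne_zero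
  have hdetT : B.transpose.det ≠ 0 := by rwa [Matrix.det_transpose]
  set T : (Fin d → ℝ) →ₗ[ℝ] (Fin d → ℝ) := Matrix.toLin' B.transpose with hT
  have hTdet : LinearMap.det T = B.det := by
    rw [hT, LinearMap.det_toLin', Matrix.det_transpose]
  set ι : Q → UnitAddTorus (Fin d) := fun x => torusMk (T x.1.ofLp) with hιdef
  have hTinj : Function.Injective T := by
    intro x y h
    have := congrArg (B.transpose⁻¹).mulVec h
    simpa [hT, Matrix.mulVec_mulVec, Matrix.nonsing_inv_mul _ hdetT.isUnit] using this
  have hιinj : Function.Injective ι := by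
    intro x y hxy
    obtain ⟨k, hk⟩ := torusMk_eq_iff.1 hxy
    have hk' : B.transpose.mulVec (x.1 - y.1).ofLp = intVec k := by
      rw [WithLp.ofLp_sub, Matrix.mulVec_sub, sub_eq_iff_eq_add']
      exact hk.symm
    have h0 : k = 0 := by
      refine hpack x.1 x.2 y.1 y.2 k ?_
      rw [← hk', Matrix.mulVec_mulVec, Matrix.nonsing_inv_mul _ hdetT.isUnit, Matrix.one_mulVec]
    subst h0
    have hz : intVec (0 : Fin d → ℤ) = 0 := by
      funext i
      simp [intVec]
    rw [hz, add_zero] at hk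
    exact Subtype.ext (WithLp.ofLp_injective 2 (hTinj hk.symm))
  have hιmeas : Measurable ι := by
    refine continuous_torusMk.measurable.comp ?_
    have h1 : Continuous T := T.continuous_of_finiteDimensional
    exact (h1.comp (PiLp.continuous_ofLp 2 _)).measurable.comp measurable_subtype_coe
  -- By Lusin–Souslin, an injective measurable map out of a standard Borel space is a measurable
  -- embedding.
  have : StandardBorelSpace Q := hQ.standardBorel
  have hι : MeasurableEmbedding ι := hιmeas.measurableEmbedding hιinj
  -- Change of variables: `Bᵀ` scales volume by `|det B|`, and reduction mod `ℤ^d` preserves it on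
  -- the image of `Q`.
  have hcomap : Measure.comap ι volume
      = ENNReal.ofReal |B.det| • Measure.comap Subtype.val volume := by
    ext A hA
    have hA' : MeasurableSet (Subtype.val '' A) := hQ.subtype_image hA
    have e1 : WithLp.ofLp '' (Subtype.val '' A) = WithLp.toLp 2 ⁻¹' (Subtype.val '' A) := by
      ext z
      constructor
      · rintro ⟨x, hx, rfl⟩
        exact hx
      · intro hz
        exact ⟨_, hz, rfl⟩
    have e2 : ι '' A = torusMk '' (T '' (WithLp.ofLp '' (Subtype.val '' A))) := by
      simp only [Set.image_image, hιdef]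
    have hm : MeasurableSet (WithLp.ofLp '' (Subtype.val '' A)) := by
      rw [e1]
      exact (PiLp.volume_preserving_toLp (Fin d)).measurable hA'
    have hm2 : MeasurableSet (T '' (WithLp.ofLp '' (Subtype.val '' A))) :=
      hm.image_of_continuousOn_injOn
        (T.continuous_of_finiteDimensional).continuousOn hTinj.injOn
    have hi : Set.InjOn torusMk (T '' (WithLp.ofLp '' (Subtype.val '' A))) := by
      rintro _ ⟨_, ⟨_, ⟨x, _, rfl⟩, rfl⟩, rfl⟩ _ ⟨_, ⟨_, ⟨y, _, rfl⟩, rfl⟩, rfl⟩ hxy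
      rw [hιinj (a₁ := x) (a₂ := y) hxy]
    rw [hι.comap_apply, Measure.smul_apply,
      (MeasurableEmbedding.subtype_coe hQ).comap_apply, e2, volume_torusMk_image hm2 hi,
      Measure.addHaar_image_linearMap, hTdet, e1,
      (PiLp.volume_preserving_toLp (Fin d)).measure_preimage hA'.nullMeasurableSet, smul_eq_mul]
  have hint : ∀ f : EuclideanSpace ℝ (Fin d) → ℂ,
      ∫ x : Q, f x ∂(Measure.comap ι volume) = ((|B.det| : ℝ) : ℂ) * ∫ x in Q, f x := by
    intro f
    rw [hcomap, integral_smul_measure, integral_subtype_comap hQ f,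
      ENNReal.toReal_ofReal (abs_nonneg _), Complex.real_smul]
  have hmem : ∀ w : EuclideanSpace ℝ (Fin d) → ℂ, MemLp w 2 (volume.restrict Q) →
      MemLp (fun x : Q => w x) 2 (Measure.comap ι volume) := by
    intro w hw
    rw [hcomap]
    refine MemLp.smul_measure ?_ ENNReal.ofReal_ne_top
    rw [← map_comap_subtype_coe hQ,
      (MeasurableEmbedding.subtype_coe hQ).memLp_map_measure_iff] at hw
    exact hw
  have hexp : ∀ (m : Fin d → ℤ) (x : Q), UnitAddTorus.mFourier (-m) (ι x) =
      Complex.exp (-(2 * Real.pi * Complex.I *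
        (inner ℝ (WithLp.toLp 2 (B.mulVec (intVec m))) x.1 : ℝ))) := by
    intro m x
    have hin : inner ℝ (WithLp.toLp 2 (B.mulVec (intVec m))) x.1
        = ∑ i, (m i : ℝ) * T x.1.ofLp i := by
      have : inner ℝ (WithLp.toLp 2 (B.mulVec (intVec m))) x.1
          = x.1.ofLp ⬝ᵥ B.mulVec (intVec m) := by
        simp [PiLp.inner_apply, dotProduct]
      rw [this, Matrix.dotProduct_mulVec, ← Matrix.mulVec_transpose, dotProduct_comm]
      rfl
    rw [hin]
    simp only [UnitAddTorus.mFourier, ContinuousMap.coe_mk, hιdef, torusMk, fourier_coe_apply,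
      ← Complex.exp_sum]
    congr 1
    push_cast
    rw [Finset.mul_sum, ← Finset.sum_neg_distrib]
    refine Finset.sum_congr rfl fun i _ => ?_
    simp only [Pi.neg_apply]
    push_cast
    ring
  have h := hasSum_mFourier_of_measurableEmbedding hι (hmem u hu) (hmem v hv)
  simp only [hexp] at h
  rw [hint fun x => conj (u x) * v x] at h
  have hd : ((|B.det| : ℝ) : ℂ) ≠ 0 := by
    exact_mod_cast abs_ne_zero.2 hdet
  -- Each integral pulled back from the torus carries a factor `|det B|`: two in every term of the
  -- series, one in its sum.
  have h2 := h.mul_left (((|B.det| : ℝ) : ℂ)⁻¹ ^ 2)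
  have e : ((|B.det| : ℝ) : ℂ)⁻¹ ^ 2 * (((|B.det| : ℝ) : ℂ) * ∫ x in Q, conj (u x) * v x)
      = ((|B.det|⁻¹ : ℝ) : ℂ) * ∫ x in Q, conj (u x) * v x := by
    push_cast
    field_simp
  rw [e] at h2
  refine h2.congr_fun fun m => ?_
  rw [hint fun x => Complex.exp (-(2 * Real.pi * Complex.I *
      (inner ℝ (WithLp.toLp 2 (B.mulVec (intVec m))) x : ℝ))) * u x,
    hint fun x => Complex.exp (-(2 * Real.pi * Complex.I *
      (inner ℝ (WithLp.toLp 2 (B.mulVec (intVec m))) x : ℝ))) * v x, map_mul, Complex.conj_ofReal]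
  field_simp

end TorusParseval

/-! ### Bessel families and dual frames in Hilbert space. -/

section Bessel

variable {ι H : Type*} [NormedAddCommGroup H] [InnerProductSpace ℂ H]

/-- The analysis operator of a Bessel family, with values in `ℓ²`. -/
theorem exists_analysis_of_bessel {F : ι → H} {b : ℝ} (hb : 0 < b)
    (hF : ∀ f : H, Summable (fun i => ‖inner ℂ (F i) f‖ ^ 2) ∧
      ∑' i, ‖inner ℂ (F i) f‖ ^ 2 ≤ b * ‖f‖ ^ 2) :
    ∃ T : H →L[ℂ] lp (fun _ : ι => ℂ) 2, (∀ f i, T f i = inner ℂ (F i) f) ∧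
      ∀ f, ‖T f‖ ^ 2 = ∑' i, ‖inner ℂ (F i) f‖ ^ 2 := by
  have hmem : ∀ f, Memℓp (fun i => inner ℂ (F i) f) 2 := fun f => by
    rw [memℓp_gen_iff (by norm_num)]
    simpa using (hF f).1
  let T₀ : H →ₗ[ℂ] lp (fun _ : ι => ℂ) 2 :=
    { toFun := fun f => ⟨fun i => inner ℂ (F i) f, hmem f⟩
      map_add' := fun f g => by
        ext i
        exact inner_add_right _ _ _
      map_smul' := fun a f => by
        ext i
        exact inner_smul_right _ _ _ }
  have hnorm : ∀ f, ‖T₀ f‖ ^ 2 = ∑' i, ‖inner ℂ (F i) f‖ ^ 2 := by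
    intro f
    have := lp.norm_rpow_eq_tsum (p := 2) (by norm_num) (T₀ f)
    simp only [ENNReal.toReal_ofNat, Real.rpow_ofNat] at this
    exact this
  refine ⟨T₀.mkContinuous (Real.sqrt b) fun f => ?_, fun f i => rfl, hnorm⟩
  refine le_of_sq_le_sq ?_ (by positivity)
  rw [hnorm, mul_pow, Real.sq_sqrt hb.le]
  exact (hF f).2

/-- The hypothesis `hrec` says `T'* T = 1`. Applying the continuous map `T'*` to the expansion of `T
f` in the unit vectors of `ℓ²` gives the series, with unconditional convergence. -/
theorem hasSum_of_analysis [CompleteSpace H] {F F' : ι → H} {T T' : H →L[ℂ] lp (fun _ : ι => ℂ) 2}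
    (hT : ∀ f i, T f i = inner ℂ (F i) f) (hT' : ∀ f i, T' f i = inner ℂ (F' i) f)
    (hrec : ∀ f u : H, HasSum (fun i => inner ℂ u (F' i) * inner ℂ (F i) f) (inner ℂ u f))
    (f : H) : HasSum (fun i => inner ℂ (F i) f • F' i) f := by
  classical
  have hTT : ∀ u, inner ℂ (T' u) (T f) = inner ℂ u f := by
    intro u
    rw [lp.inner_eq_tsum, ← (hrec f u).tsum_eq]
    refine tsum_congr fun i => ?_
    rw [hT, hT', RCLike.inner_apply, inner_conj_symm, mul_comm]
  have h := (ContinuousLinearMap.adjoint T').hasSum (lp.hasSum_single (by simp) (T f))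
  have e : ContinuousLinearMap.adjoint T' (T f) = f := by
    refine ext_inner_left ℂ fun u => ?_
    rw [ContinuousLinearMap.adjoint_inner_right, hTT]
  rw [e] at h
  refine h.congr_fun fun i => ?_
  refine ext_inner_left ℂ fun u => ?_
  rw [ContinuousLinearMap.adjoint_inner_right, lp.inner_single_right, hT, hT', inner_smul_right,
    RCLike.inner_apply, inner_conj_symm]

/-- The lower bound is Cauchy–Schwarz: `‖f‖² = ⟨T' f, T f⟩ ≤ √b' ‖f‖ ‖T f‖`, so the upper bound `b'`
of one family yields the lower bound `1/b'` of the other. -/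
theorem isFrame_of_analysis {F F' : ι → H} {b b' : ℝ} (hb : 0 < b) (hb' : 0 < b')
    (hF : ∀ f : H, Summable (fun i => ‖inner ℂ (F i) f‖ ^ 2) ∧
      ∑' i, ‖inner ℂ (F i) f‖ ^ 2 ≤ b * ‖f‖ ^ 2)
    (hF' : ∀ f : H, Summable (fun i => ‖inner ℂ (F' i) f‖ ^ 2) ∧
      ∑' i, ‖inner ℂ (F' i) f‖ ^ 2 ≤ b' * ‖f‖ ^ 2)
    (hrec : ∀ f u : H, HasSum (fun i => inner ℂ u (F' i) * inner ℂ (F i) f) (inner ℂ u f)) :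
    IsFrame F := by
  obtain ⟨T, hT, hTn⟩ := exists_analysis_of_bessel hb hF
  obtain ⟨T', hT', hTn'⟩ := exists_analysis_of_bessel hb' hF'
  refine ⟨b'⁻¹, b, inv_pos.2 hb', hb, fun f => ⟨(hF f).1, ?_, (hF f).2⟩⟩
  have h1 : inner ℂ (T' f) (T f) = inner ℂ f f := by
    rw [lp.inner_eq_tsum, ← (hrec f f).tsum_eq]
    refine tsum_congr fun i => ?_
    rw [hT, hT', RCLike.inner_apply, inner_conj_symm, mul_comm]
  have h2 : ‖f‖ ^ 2 ≤ ‖T' f‖ * ‖T f‖ := by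
    have := norm_inner_le_norm (𝕜 := ℂ) (T' f) (T f)
    rw [h1, inner_self_eq_norm_sq_to_K] at this
    simpa using this
  have h3 : ‖T' f‖ ^ 2 ≤ b' * ‖f‖ ^ 2 := (hTn' f).trans_le (hF' f).2
  rw [← hTn, inv_mul_le_iff₀ hb']
  rcases eq_or_ne f 0 with rfl | hf
  · simp
  have hf0 : 0 < ‖f‖ ^ 2 := by positivity
  have h4 : (‖f‖ ^ 2) ^ 2 ≤ (b' * ‖f‖ ^ 2) * ‖T f‖ ^ 2 :=
    calc (‖f‖ ^ 2) ^ 2 ≤ (‖T' f‖ * ‖T f‖) ^ 2 := by gcongr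
      _ = ‖T' f‖ ^ 2 * ‖T f‖ ^ 2 := mul_pow _ _ _
      _ ≤ _ := by gcongr
  refine le_of_mul_le_mul_left ?_ hf0
  calc ‖f‖ ^ 2 * ‖f‖ ^ 2 = (‖f‖ ^ 2) ^ 2 := by ring
    _ ≤ _ := h4
    _ = _ := by ring

/-- Two Bessel families that reproduce the inner product weakly are dual frames. -/
theorem isDualFramePair_of_bessel [CompleteSpace H] {F F' : ι → H} {b b' : ℝ} (hb : 0 < b) (hb' : 0 < b')
    (hF : ∀ f : H, Summable (fun i => ‖inner ℂ (F i) f‖ ^ 2) ∧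
      ∑' i, ‖inner ℂ (F i) f‖ ^ 2 ≤ b * ‖f‖ ^ 2)
    (hF' : ∀ f : H, Summable (fun i => ‖inner ℂ (F' i) f‖ ^ 2) ∧
      ∑' i, ‖inner ℂ (F' i) f‖ ^ 2 ≤ b' * ‖f‖ ^ 2)
    (hrec : ∀ f u : H, HasSum (fun i => inner ℂ u (F' i) * inner ℂ (F i) f) (inner ℂ u f)) :
    IsDualFramePair F F' := by
  have hrec' : ∀ f u : H,
      HasSum (fun i => inner ℂ u (F i) * inner ℂ (F' i) f) (inner ℂ u f) := by
    intro f u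
    have h := (hrec u f).star
    simp only [star_mul, RCLike.star_def, inner_conj_symm] at h
    exact h
  obtain ⟨T, hT, -⟩ := exists_analysis_of_bessel hb hF
  obtain ⟨T', hT', -⟩ := exists_analysis_of_bessel hb' hF'
  exact ⟨isFrame_of_analysis hb hb' hF hF' hrec, isFrame_of_analysis hb' hb hF' hF hrec',
    hasSum_of_analysis hT hT' hrec, hasSum_of_analysis hT' hT hrec'⟩

end Bessel

/-! ### Smoothness of the truncated windows. -/

section Smoothness

/-- The truncation of a differentiable function to a set on whose frontier the function and its
derivative vanish is differentiable. -/
theorem hasDerivAt_indicator {f f' : ℝ → ℝ} {s : Set ℝ} (hf : ∀ t, HasDerivAt f (f' t) t)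
    (h0 : ∀ t ∈ frontier s, f t = 0) (h1 : ∀ t ∈ frontier s, f' t = 0) (t : ℝ) :
    HasDerivAt (s.indicator f) (s.indicator f' t) t := by
  by_cases ht : t ∈ frontier s
  · have e : s.indicator f' t = 0 := by
      by_cases hts : t ∈ s
      · rw [Set.indicator_of_mem hts, h1 t ht]
      · exact Set.indicator_of_notMem hts _
    have e0 : s.indicator f t = 0 := by
      by_cases hts : t ∈ s
      · rw [Set.indicator_of_mem hts, h0 t ht]
      · exact Set.indicator_of_notMem hts _
    have h := hf t
    rw [h1 t ht, hasDerivAt_iff_isLittleO] at h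
    rw [e, hasDerivAt_iff_isLittleO]
    -- At a frontier point `f x = o(x - t)`, and truncation can only decrease `|f|`.
    refine Asymptotics.IsBigO.trans_isLittleO (Asymptotics.IsBigO.of_bound 1 ?_) h
    refine Filter.Eventually.of_forall fun x => ?_
    simp only [e0, h0 t ht, sub_zero, smul_zero, one_mul]
    exact norm_indicator_le_norm_self f x
  · by_cases hts : t ∈ s
    · have hi : s ∈ nhds t := by
        rw [mem_interior_iff_mem_nhds.symm]
        by_contra hc
        exact ht ⟨subset_closure hts, hc⟩
      rw [Set.indicator_of_mem hts]
      refine (hf t).congr_of_eventuallyEq ?_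
      filter_upwards [hi] with x hx
      exact Set.indicator_of_mem hx f
    · have hc : sᶜ ∈ nhds t := by
        have h2 : t ∈ interior sᶜ := by
          by_contra hc
          rw [interior_compl, Set.mem_compl_iff, not_not] at hc
          exact ht ⟨hc, fun h => hts (interior_subset h)⟩
        exact mem_interior_iff_mem_nhds.1 h2
      rw [Set.indicator_of_notMem hts]
      refine (hasDerivAt_const t (0 : ℝ)).congr_of_eventuallyEq ?_
      filter_upwards [hc] with x hx
      exact Set.indicator_of_notMem hx f

/-- If `p` is smooth and vanishes on the frontier of `s`, then truncating `p^(n+1) u` to `s`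
gives a `C^n` function. -/
theorem contDiff_indicator_pow_mul {p : ℝ → ℝ} {s : Set ℝ} (hp : ContDiff ℝ ⊤ p)
    (h0 : ∀ t ∈ frontier s, p t = 0) (n : ℕ) :
    ∀ u : ℝ → ℝ, ContDiff ℝ ⊤ u →
      ContDiff ℝ n (s.indicator fun t => p t ^ (n + 1) * u t) := by
  induction n with
  | zero =>
    intro u hu
    rw [Nat.cast_zero, contDiff_zero]
    refine continuous_indicator (fun t ht => by simp [h0 t ht]) ?_
    exact ((hp.continuous.pow _).mul hu.continuous).continuousOn
  | succ n ih =>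
    intro u hu
    have hp' : Differentiable ℝ p := hp.differentiable (by simp)
    have hu' : Differentiable ℝ u := hu.differentiable (by simp)
    have hdp : ContDiff ℝ ⊤ (deriv p) := (contDiff_succ_iff_deriv (n := ⊤)).1 hp |>.2.2
    have hdu : ContDiff ℝ ⊤ (deriv u) := (contDiff_succ_iff_deriv (n := ⊤)).1 hu |>.2.2
    -- The derivative of `p^(n+2) u` is `p^(n+1)` times another smooth function, so the induction
    -- must run over all `u`.
    have hder := hasDerivAt_indicator (s := s) (f := fun t => p t ^ (n + 1 + 1) * u t)
      (f' := fun t => p t ^ (n + 1) * (((n : ℝ) + 2) * deriv p t * u t + p t * deriv u t))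
      (fun t => by
        have := ((hp' t).hasDerivAt.pow (n + 1 + 1)).mul (hu' t).hasDerivAt
        refine this.congr_deriv ?_
        rw [Nat.add_sub_cancel, Pi.pow_apply]
        push_cast
        ring)
      (fun t ht => by simp [h0 t ht]) (fun t ht => by simp [h0 t ht])
    push_cast
    rw [contDiff_succ_iff_deriv]
    refine ⟨fun t => (hder t).differentiableAt, by simp, ?_⟩
    rw [funext fun t => (hder t).deriv]
    exact ih _ (((contDiff_const.mul hdp).mul hu).add (hp.mul hdu))

theorem contDiff_indicator_sin_pow {M N : ℕ} (hM : 1 ≤ M) (hN : 1 ≤ N) :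
    ContDiff ℝ ((M - 1 : ℕ) : ℕ∞)
      ((Set.Icc (0 : ℝ) N).indicator fun t => Real.sin (Real.pi * t / N) ^ M) := by
  obtain ⟨n, rfl⟩ : ∃ n, M = n + 1 := ⟨M - 1, by omega⟩
  have hN' : (0 : ℝ) < N := by exact_mod_cast hN
  have h := contDiff_indicator_pow_mul (p := fun t => Real.sin (Real.pi * t / N))
    (s := Set.Icc (0 : ℝ) N)
    (Real.contDiff_sin.comp ((contDiff_const.mul contDiff_id).div_const _)) (by
      intro t ht
      rw [frontier_Icc hN'.le] at ht
      rcases ht with rfl | rfl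
      · simp
      · rw [mul_div_assoc, div_self hN'.ne', mul_one, Real.sin_pi]) n (fun _ => 1) contDiff_const
  simpa using h

/-- The indicator of a cube is a product over coordinates, which reduces regularity to one variable.
-/
theorem sinWindow_eq_prod {d M N : ℕ} (G : EuclideanSpace ℝ (Fin d) → ℝ)
    (x : EuclideanSpace ℝ (Fin d)) :
    sinWindow M N G x = (((∏ j, (Set.Icc (0 : ℝ) N).indicator
      (fun t => Real.sin (Real.pi * t / N) ^ M) (x j)) * G x : ℝ) : ℂ) := by
  by_cases hx : x ∈ cube d N
  · rw [sinWindow, Set.indicator_of_mem hx]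
    congr 2
    exact Finset.prod_congr rfl fun j _ => (Set.indicator_of_mem (hx j)
      fun t => Real.sin (Real.pi * t / N) ^ M).symm
  · rw [sinWindow, Set.indicator_of_notMem hx]
    obtain ⟨j, hj⟩ : ∃ j, x j ∉ Set.Icc (0 : ℝ) N := by
      simpa [cube] using hx
    rw [Finset.prod_eq_zero (Finset.mem_univ j) (Set.indicator_of_notMem hj _)]
    simp

theorem contDiff_trigPoly {d : ℕ} (N : ℕ) (S : Finset (Fin d → ℤ)) (c : (Fin d → ℤ) → ℂ)
    {n : WithTop ℕ∞} : ContDiff ℝ n (trigPoly N S c) := by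
  unfold trigPoly
  refine ContDiff.sum fun k _ => contDiff_const.mul (Complex.contDiff_exp.comp ?_)
  refine (contDiff_const.mul (ContDiff.sum fun j _ => contDiff_const.mul ?_)).div_const _
  exact Complex.ofRealCLM.contDiff.comp (EuclideanSpace.proj (𝕜 := ℝ) j).contDiff

theorem IsRealTrigPoly.contDiff {d N : ℕ} {G : EuclideanSpace ℝ (Fin d) → ℝ}
    (hG : IsRealTrigPoly N G) {n : WithTop ℕ∞} : ContDiff ℝ n G := by
  obtain ⟨S, c, h⟩ := hG
  have : G = fun x => (trigPoly N S c x).re := by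
    funext x
    rw [← h, Complex.ofReal_re]
  rw [this]
  exact Complex.reCLM.contDiff.comp (contDiff_trigPoly N S c)

theorem contDiff_sinWindow {d M N : ℕ} (hM : 1 ≤ M) (hN : 1 ≤ N)
    {G : EuclideanSpace ℝ (Fin d) → ℝ} (hG : IsRealTrigPoly N G) :
    ContDiff ℝ ((M - 1 : ℕ) : ℕ∞) (sinWindow M N G) := by
  rw [funext (sinWindow_eq_prod G)]
  refine Complex.ofRealCLM.contDiff.comp (ContDiff.mul (contDiff_prod fun j _ => ?_) hG.contDiff)
  exact (contDiff_indicator_sin_pow hM hN).comp (EuclideanSpace.proj (𝕜 := ℝ) j).contDiff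

end Smoothness

/-! ### The integer translates of `P` over a box sum to one. -/

section PartitionOfUnity

theorem sum_range_exp_int {N : ℕ} (hN : 1 ≤ N) (a : ℤ) :
    ∑ r ∈ Finset.range N, Complex.exp (2 * Real.pi * Complex.I * ((a : ℂ) * r) / N)
      = if (N : ℤ) ∣ a then (N : ℂ) else 0 := by
  have hN0 : (N : ℂ) ≠ 0 := by exact_mod_cast (by omega : N ≠ 0)
  have hζ := Complex.isPrimitiveRoot_exp N (by omega)
  set ζ := Complex.exp (2 * Real.pi * Complex.I / N) with hζdef
  have hterm : ∀ r ∈ Finset.range N,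
      Complex.exp (2 * Real.pi * Complex.I * ((a : ℂ) * r) / N) = (ζ ^ a) ^ r := by
    intro r _
    rw [hζdef, ← Complex.exp_int_mul, ← Complex.exp_nat_mul]
    congr 1
    ring
  rw [Finset.sum_congr rfl hterm]
  split_ifs with h
  · rw [(hζ.zpow_eq_one_iff_dvd a).2 h]
    simp
  · have h1 : ζ ^ a ≠ 1 := fun h' => h ((hζ.zpow_eq_one_iff_dvd a).1 h')
    have h2 : (ζ ^ a) ^ N = 1 := by
      rw [← zpow_natCast, ← zpow_mul, mul_comm, zpow_mul, zpow_natCast, hζ.pow_eq_one, one_zpow]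
    rw [geom_sum_eq h1, h2, sub_self, zero_div]

/-- The integer vectors of `[0,N)^d`. -/
def intBox (d N : ℕ) : Finset (Fin d → ℕ) := Fintype.piFinset fun _ => Finset.range N

/-- Averaging a trigonometric polynomial over the translates by `{0, …, N-1}^d` keeps only the
frequencies in `(Nℤ)^d`. -/
theorem sum_trigPoly_intBox {d N : ℕ} (hN : 1 ≤ N) (S : Finset (Fin d → ℤ))
    (c : (Fin d → ℤ) → ℂ) (y : EuclideanSpace ℝ (Fin d)) :
    ∑ r ∈ intBox d N, trigPoly N S c (y + WithLp.toLp 2 fun j => (r j : ℝ))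
      = trigPoly N S (fun k => if ∀ j, (N : ℤ) ∣ k j then (N : ℂ) ^ d * c k else 0) y := by
  have hN0 : (N : ℂ) ≠ 0 := by exact_mod_cast (by omega : N ≠ 0)
  unfold trigPoly
  rw [Finset.sum_comm]
  refine Finset.sum_congr rfl fun k _ => ?_
  have h1 : ∀ r : Fin d → ℕ, c k * Complex.exp (2 * Real.pi * Complex.I *
      (∑ j, (k j : ℂ) * (((y + WithLp.toLp 2 fun j => (r j : ℝ)) j : ℝ) : ℂ)) / N)
      = c k * Complex.exp (2 * Real.pi * Complex.I * (∑ j, (k j : ℂ) * (y j : ℂ)) / N) *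
        ∏ j, Complex.exp (2 * Real.pi * Complex.I * ((k j : ℂ) * r j) / N) := by
    intro r
    rw [← Complex.exp_sum, mul_assoc (c k), ← Complex.exp_add]
    congr 2
    rw [← Finset.sum_div, ← Finset.mul_sum, ← add_div, ← mul_add, ← Finset.sum_add_distrib]
    congr 2
    refine Finset.sum_congr rfl fun j _ => ?_
    simp only [PiLp.add_apply]
    push_cast
    ring
  simp only [h1]
  -- The sum over the box factors into one-dimensional geometric sums of `N`-th roots of unity.
  rw [← Finset.mul_sum, intBox,
    ← Finset.prod_univ_sum (fun _ => Finset.range N)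
      (fun j r => Complex.exp (2 * Real.pi * Complex.I * ((k j : ℂ) * r) / N))]
  simp only [sum_range_exp_int hN]
  split_ifs with h
  · rw [Finset.prod_congr rfl fun j _ => if_pos (h j)]
    simp
    ring
  · push Not at h
    obtain ⟨j, hj⟩ := h
    rw [Finset.prod_eq_zero (Finset.mem_univ j) (if_neg hj)]
    simp

theorem sum_intBox_eq_one {d K N : ℕ} (hN : 1 ≤ N) {c : (Fin d → ℤ) → ℂ}
    {P : EuclideanSpace ℝ (Fin d) → ℝ} (hP : ∀ x, (P x : ℂ) = trigPoly N (freqBox d K) c x)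
    (hc : ∀ k ∈ freqBox d K, (∀ j, (N : ℤ) ∣ k j) →
      c k = if k = 0 then 1 / (N : ℂ) ^ d else 0) (y : EuclideanSpace ℝ (Fin d)) :
    ∑ r ∈ intBox d N, P (y + WithLp.toLp 2 fun j => (r j : ℝ)) = 1 := by
  have hN0 : (N : ℂ) ≠ 0 := by exact_mod_cast (by omega : N ≠ 0)
  rw [← Complex.ofReal_inj]
  push_cast
  simp only [hP]
  rw [sum_trigPoly_intBox hN, trigPoly, Finset.sum_eq_single 0]
  · rw [if_pos (by simp), hc 0 (by simp [freqBox]) (by simp)]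
    simp [hN0]
  · intro k hk hk0
    split_ifs with h
    · rw [hc k hk h, if_neg hk0]
      simp
    · simp
  · intro h
    exact absurd (by simp [freqBox]) h

end PartitionOfUnity

/-! ### Sums over integer translates. -/

section Translates

open scoped ComplexConjugate

/-- The half-open cube `[0,N)^d`. -/
def halfOpenCube (d N : ℕ) : Set (EuclideanSpace ℝ (Fin d)) :=
  {x | ∀ j, x j ∈ Set.Ico (0 : ℝ) (N : ℝ)}

theorem measurableSet_halfOpenCube {d N : ℕ} : MeasurableSet (halfOpenCube d N) := by
  have : halfOpenCube d N = ⋂ j, (fun x : EuclideanSpace ℝ (Fin d) => x j) ⁻¹' Set.Ico 0 N := by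
    ext x
    simp [halfOpenCube]
  rw [this]
  exact MeasurableSet.iInter fun j =>
    (EuclideanSpace.proj (𝕜 := ℝ) j).continuous.measurable measurableSet_Ico

theorem isCompact_cube {d N : ℕ} : IsCompact (cube d N) := by
  have : cube d N = WithLp.toLp 2 '' Set.univ.pi fun _ : Fin d => Set.Icc (0 : ℝ) N := by
    ext x
    constructor
    · exact fun hx => ⟨x.ofLp, fun j _ => hx j, rfl⟩
    · rintro ⟨y, hy, rfl⟩ j
      exact hy j trivial
  rw [this]
  exact (isCompact_univ_pi fun _ => isCompact_Icc).image (PiLp.continuous_toLp 2 _)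

theorem halfOpenCube_subset_cube {d N : ℕ} : halfOpenCube d N ⊆ cube d N :=
  fun _ hx j => ⟨(hx j).1, (hx j).2.le⟩

theorem hasCompactSupport_of_halfOpenCube {d N : ℕ} {g : EuclideanSpace ℝ (Fin d) → ℂ}
    (h0 : ∀ x ∉ halfOpenCube d N, g x = 0) : HasCompactSupport g :=
  HasCompactSupport.intro isCompact_cube fun _ hx => h0 _ fun h => hx (halfOpenCube_subset_cube h)

/-- The sum of the integer translates of a function living on `[0,N)^d` is a finite sum. -/
theorem hasSum_translates {d N : ℕ} {E : Type*} [AddCommMonoid E] [TopologicalSpace E]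
    {w : EuclideanSpace ℝ (Fin d) → E} (h0 : ∀ x ∉ halfOpenCube d N, w x = 0)
    (x : EuclideanSpace ℝ (Fin d)) :
    HasSum (fun n : Fin d → ℤ => w (x - WithLp.toLp 2 (intVec n)))
      (∑ r ∈ intBox d N,
        w (WithLp.toLp 2 (fun j => Int.fract (x j)) + WithLp.toLp 2 fun j => (r j : ℝ))) := by
  -- With `n = ⌊x⌋ - r` one has `x - n = fract x + r`. Any `n` outside the range of `φ` makes some
  -- coordinate of `x - n` negative.
  let φ : (Fin d → ℕ) → (Fin d → ℤ) := fun r j => ⌊x j⌋ - r j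
  have hφ : Function.Injective φ := by
    intro a b h
    funext j
    have := congrFun h j
    simp only [φ] at this
    omega
  have hval : ∀ r : Fin d → ℕ, x - WithLp.toLp 2 (intVec (φ r))
      = WithLp.toLp 2 (fun j => Int.fract (x j)) + WithLp.toLp 2 fun j => (r j : ℝ) := by
    intro r
    ext j
    simp only [PiLp.sub_apply, PiLp.add_apply, intVec, φ, Int.fract]
    push_cast
    ring
  rw [← hφ.hasSum_iff]
  · simp only [Function.comp_def, hval]
    refine hasSum_sum_of_ne_finset_zero fun r hr => h0 _ fun hmem => hr ?_
    refine Fintype.mem_piFinset.2 fun j => Finset.mem_range.2 ?_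
    have h1 := (hmem j).2
    simp only [PiLp.add_apply] at h1
    have h2 := Int.fract_nonneg (x j)
    exact_mod_cast (by linarith : (r j : ℝ) < N)
  · intro n hn
    refine h0 _ fun hmem => hn ⟨fun j => (⌊x j⌋ - n j).toNat, ?_⟩
    funext j
    have h1 := (hmem j).1
    simp only [PiLp.sub_apply, intVec] at h1
    have h2 : n j ≤ ⌊x j⌋ := Int.le_floor.2 (by linarith)
    simp only [φ]
    omega

theorem add_mem_halfOpenCube {d N : ℕ} (x : EuclideanSpace ℝ (Fin d)) {r : Fin d → ℕ}
    (hr : r ∈ intBox d N) :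
    WithLp.toLp 2 (fun j => Int.fract (x j)) + WithLp.toLp 2 (fun j => (r j : ℝ))
      ∈ halfOpenCube d N := by
  intro j
  have h1 := Int.fract_nonneg (x j)
  have h2 := Int.fract_lt_one (x j)
  have h3 : r j + 1 ≤ N := Finset.mem_range.1 (Fintype.mem_piFinset.1 hr j)
  have h3 : (r j : ℝ) + 1 ≤ N := by exact_mod_cast h3
  simp only [PiLp.add_apply, Set.mem_Ico]
  constructor
  · positivity
  · linarith

/-- Dominated convergence. Exactly `(intBox d N).card` translates of the half-open cube contain a
given point, so the dominating terms sum to a constant times `‖φ x‖`. -/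
theorem hasSum_integral_translates {d N : ℕ} {w : EuclideanSpace ℝ (Fin d) → ℂ} {C : ℝ}
    (hw : Continuous w) (hC : ∀ x, ‖w x‖ ≤ C) (h0 : ∀ x ∉ halfOpenCube d N, w x = 0)
    {φ W : EuclideanSpace ℝ (Fin d) → ℂ} (hφ : Integrable φ)
    (hW : ∀ x, HasSum (fun n : Fin d → ℤ => w (x - WithLp.toLp 2 (intVec n))) (W x)) :
    HasSum (fun n : Fin d → ℤ => ∫ x, w (x - WithLp.toLp 2 (intVec n)) * φ x)
      (∫ x, W x * φ x) := by
  have hsum : ∀ x, HasSum (fun n : Fin d → ℤ =>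
      (halfOpenCube d N).indicator (fun _ => C) (x - WithLp.toLp 2 (intVec n)) * ‖φ x‖)
      ((intBox d N).card * C * ‖φ x‖) := by
    intro x
    have h := hasSum_translates (w := (halfOpenCube d N).indicator fun _ => C)
      (fun x hx => Set.indicator_of_notMem hx _) x
    rw [Finset.sum_congr rfl fun r hr => Set.indicator_of_mem (add_mem_halfOpenCube x hr) _,
      Finset.sum_const, nsmul_eq_mul] at h
    exact h.mul_right _
  refine hasSum_integral_of_dominated_convergence (fun n x =>
    (halfOpenCube d N).indicator (fun _ => C) (x - WithLp.toLp 2 (intVec n)) * ‖φ x‖)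
    (fun n => ?_) (fun n => ?_) ?_ ?_ ?_
  · exact (hw.comp (continuous_id.sub continuous_const)).aestronglyMeasurable.mul
      hφ.aestronglyMeasurable
  · refine Filter.Eventually.of_forall fun x => ?_
    rw [norm_mul]
    refine mul_le_mul_of_nonneg_right ?_ (norm_nonneg _)
    by_cases hx : x - WithLp.toLp 2 (intVec n) ∈ halfOpenCube d N
    · rw [Set.indicator_of_mem hx]
      exact hC _
    · rw [Set.indicator_of_notMem hx, h0 _ hx, norm_zero]
  · exact Filter.Eventually.of_forall fun x => (hsum x).summable
  · simp only [fun x => (hsum x).tsum_eq]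
    exact hφ.norm.const_mul _
  · exact Filter.Eventually.of_forall fun x => (hW x).mul_right _

end Translates

/-! ### Bessel bounds and duality for Gabor systems. -/

section Gabor

open scoped ComplexConjugate

variable {d N : ℕ} {B : Matrix (Fin d) (Fin d) ℝ} {g h : EuclideanSpace ℝ (Fin d) → ℂ}

theorem memLp_gaborSystem (hg : Continuous g) (g0 : ∀ x ∉ halfOpenCube d N, g x = 0)
    (p : (Fin d → ℤ) × (Fin d → ℤ)) : MemLp (gaborSystem B g p) 2 volume := by
  have h1 : MemLp g 2 volume :=
    hg.memLp_of_hasCompactSupport (hasCompactSupport_of_halfOpenCube g0)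
  have h2 : MemLp (translateFn (WithLp.toLp 2 (intVec p.2)) g) 2 volume :=
    h1.comp_measurePreserving (measurePreserving_sub_right volume _)
  refine h2.of_le ?_ (Filter.Eventually.of_forall fun x => ?_)
  · have hc : Continuous fun x : EuclideanSpace ℝ (Fin d) =>
        Complex.exp (2 * Real.pi * Complex.I *
          (inner ℝ (WithLp.toLp 2 (B.mulVec (intVec p.1))) x : ℝ)) := by
      fun_prop
    exact hc.aestronglyMeasurable.mul h2.aestronglyMeasurable
  · rw [gaborSystem, modulateFn, norm_mul, mul_assoc, mul_comm Complex.I, ← mul_assoc]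
    have : (2 * Real.pi * (inner ℝ (WithLp.toLp 2 (B.mulVec (intVec p.1))) x : ℝ) : ℂ)
        = ((2 * Real.pi * inner ℝ (WithLp.toLp 2 (B.mulVec (intVec p.1))) x : ℝ) : ℂ) := by
      push_cast
      rfl
    rw [this, Complex.norm_exp_ofReal_mul_I, one_mul]

theorem memLp_conj_translate_mul (hg : Continuous g) {C : ℝ} (hC : ∀ x, ‖g x‖ ≤ C)
    (y : EuclideanSpace ℝ (Fin d)) {f : EuclideanSpace ℝ (Fin d) → ℂ} (hf : MemLp f 2 volume) :
    MemLp (fun x => conj (g (x - y)) * f x) 2 volume := by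
  refine hf.of_le_mul (c := C) ?_ (Filter.Eventually.of_forall fun x => ?_)
  · exact (Complex.continuous_conj.comp
      (hg.comp (continuous_id.sub continuous_const))).aestronglyMeasurable.mul
      hf.aestronglyMeasurable
  · rw [norm_mul, RCLike.norm_conj]
    exact mul_le_mul_of_nonneg_right (hC _) (norm_nonneg _)

theorem inner_gaborSystem (g0 : ∀ x ∉ halfOpenCube d N, g x = 0) (m n : Fin d → ℤ)
    (hgp : MemLp (gaborSystem B g (m, n)) 2 volume)
    (f : Lp ℂ 2 (volume : Measure (EuclideanSpace ℝ (Fin d)))) :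
    inner ℂ hgp.toLp f =
      ∫ x in {x | x - WithLp.toLp 2 (intVec n) ∈ halfOpenCube d N},
        Complex.exp (-(2 * Real.pi * Complex.I *
          (inner ℝ (WithLp.toLp 2 (B.mulVec (intVec m))) x : ℝ))) *
            (conj (g (x - WithLp.toLp 2 (intVec n))) * f x) := by
  rw [setIntegral_eq_integral_of_forall_compl_eq_zero, L2.inner_def]
  · refine integral_congr_ae ?_
    filter_upwards [hgp.coeFn_toLp] with x hx
    rw [hx, RCLike.inner_apply, gaborSystem, modulateFn, translateFn, map_mul, ← Complex.exp_conj]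
    simp only [map_mul, Complex.conj_I, Complex.conj_ofReal, map_ofNat]
    rw [mul_comm, mul_assoc]
    congr 2
    ring
  · intro x hx
    rw [g0 _ hx]
    simp

/-- Parseval's identity in the modulation parameter. -/
theorem hasSum_inner_gaborSystem (hB : IsUnit B)
    (hBsharp : ∀ n : Fin d → ℤ, n ≠ 0 →
      ¬ ∀ j, (B.transpose⁻¹).mulVec (intVec n) j ∈ Set.Ioo (-(N : ℝ)) (N : ℝ))
    (hg : Continuous g) (g0 : ∀ x ∉ halfOpenCube d N, g x = 0)
    (hh : Continuous h) (h0 : ∀ x ∉ halfOpenCube d N, h x = 0)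
    (f u : Lp ℂ 2 (volume : Measure (EuclideanSpace ℝ (Fin d)))) (n : Fin d → ℤ) :
    HasSum (fun m => inner ℂ u (memLp_gaborSystem (B := B) hh h0 (m, n)).toLp *
        inner ℂ (memLp_gaborSystem (B := B) hg g0 (m, n)).toLp f)
      (((|B.det|⁻¹ : ℝ) : ℂ) * ∫ x, (conj (g (x - WithLp.toLp 2 (intVec n))) *
        h (x - WithLp.toLp 2 (intVec n))) * (conj (u x) * f x)) := by
  obtain ⟨C, hC⟩ := (hasCompactSupport_of_halfOpenCube g0).exists_bound_of_continuous hg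
  obtain ⟨D, hD⟩ := (hasCompactSupport_of_halfOpenCube h0).exists_bound_of_continuous hh
  set Q := {x | x - WithLp.toLp 2 (intVec n) ∈ halfOpenCube d N} with hQdef
  have hQ : MeasurableSet Q :=
    (measurable_id.sub_const (WithLp.toLp 2 (intVec n))) measurableSet_halfOpenCube
  -- Differences of points of the half-open cube lie strictly between `-N` and `N` in each
  -- coordinate; this is exactly what `hBsharp` forbids for nonzero lattice vectors.
  have key := hasSum_integral_exp_of_packing hB hQ (by
      intro x hx y hy k hk
      by_contra hk0
      refine hBsharp k hk0 fun j => ?_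
      rw [hk]
      have a := hx j
      have b := hy j
      simp only [PiLp.sub_apply, Set.mem_Ico, Set.mem_Ioo] at a b ⊢
      constructor <;> linarith)
    ((memLp_conj_translate_mul hh hD (WithLp.toLp 2 (intVec n)) (Lp.memLp u)).restrict Q)
    ((memLp_conj_translate_mul hg hC (WithLp.toLp 2 (intVec n)) (Lp.memLp f)).restrict Q)
  have e : ∫ x in Q, conj (conj (h (x - WithLp.toLp 2 (intVec n))) * u x) *
        (conj (g (x - WithLp.toLp 2 (intVec n))) * f x)
      = ∫ x, (conj (g (x - WithLp.toLp 2 (intVec n))) *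
        h (x - WithLp.toLp 2 (intVec n))) * (conj (u x) * f x) := by
    rw [setIntegral_eq_integral_of_forall_compl_eq_zero]
    · congr 1
      funext x
      simp only [map_mul, Complex.conj_conj]
      ring
    · intro x hx
      rw [g0 _ hx]
      simp
  rw [e] at key
  refine key.congr_fun fun m => ?_
  rw [← inner_conj_symm, inner_gaborSystem h0, inner_gaborSystem g0]

theorem integrable_conj_mul (f u : Lp ℂ 2 (volume : Measure (EuclideanSpace ℝ (Fin d)))) :
    Integrable fun x => conj (u x) * f x := by
  simpa [RCLike.inner_apply, mul_comm] using L2.integrable_inner (𝕜 := ℂ) u f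

theorem integral_conj_mul (f u : Lp ℂ 2 (volume : Measure (EuclideanSpace ℝ (Fin d)))) :
    ∫ x, conj (u x) * f x = inner ℂ u f := by
  rw [L2.inner_def]
  simp [RCLike.inner_apply, mul_comm]

/-- Parseval with both windows equal to `g` and both functions equal to `f` turns the sum over `m`
into `|det B|⁻¹ ∫ |g(x-n)|² |f|²`; the overlap count and `|g| ≤ C` then control the sum over `n`. -/
theorem exists_bessel_gaborSystem (hB : IsUnit B)
    (hBsharp : ∀ n : Fin d → ℤ, n ≠ 0 →
      ¬ ∀ j, (B.transpose⁻¹).mulVec (intVec n) j ∈ Set.Ioo (-(N : ℝ)) (N : ℝ))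
    (hg : Continuous g) (g0 : ∀ x ∉ halfOpenCube d N, g x = 0) :
    ∃ b : ℝ, 0 < b ∧ ∀ f : Lp ℂ 2 (volume : Measure (EuclideanSpace ℝ (Fin d))),
      Summable (fun p => ‖inner ℂ (memLp_gaborSystem (B := B) hg g0 p).toLp f‖ ^ 2) ∧
      ∑' p, ‖inner ℂ (memLp_gaborSystem (B := B) hg g0 p).toLp f‖ ^ 2 ≤ b * ‖f‖ ^ 2 := by
  obtain ⟨C, hC⟩ := (hasCompactSupport_of_halfOpenCube g0).exists_bound_of_continuous hg
  have hC0 : 0 ≤ C := (norm_nonneg _).trans (hC 0)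
  set b₀ : ℝ := |B.det|⁻¹ * ((intBox d N).card * (C * C)) with hb₀
  have hb₀0 : 0 ≤ b₀ := by positivity
  -- The added `1` only secures positivity: `b₀` may vanish, for instance when `g = 0`.
  refine ⟨b₀ + 1, by linarith, fun f => ?_⟩
  set a : (Fin d → ℤ) → (Fin d → ℤ) → ℝ :=
    fun n m => ‖inner ℂ (memLp_gaborSystem (B := B) hg g0 (m, n)).toLp f‖ ^ 2 with ha
  set w : EuclideanSpace ℝ (Fin d) → ℂ := fun x => conj (g x) * g x with hw
  have hwC : ∀ x, ‖w x‖ ≤ C * C := fun x => by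
    rw [hw, norm_mul, RCLike.norm_conj]
    exact mul_le_mul (hC x) (hC x) (norm_nonneg _) hC0
  have hw0 : ∀ x ∉ halfOpenCube d N, w x = 0 := fun x hx => by simp [hw, g0 x hx]
  have hfib : ∀ n, HasSum (fun m => ((a n m : ℝ) : ℂ)) (((|B.det|⁻¹ : ℝ) : ℂ) *
      ∫ x, w (x - WithLp.toLp 2 (intVec n)) * (conj (f x) * f x)) := by
    intro n
    refine (hasSum_inner_gaborSystem hB hBsharp hg g0 hg g0 f f n).congr_fun fun m => ?_
    rw [ha, ← inner_conj_symm f, ← Complex.normSq_eq_conj_mul_self, Complex.normSq_eq_norm_sq]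
  have htot := (hasSum_integral_translates
    ((Complex.continuous_conj.comp hg).mul hg) hwC hw0 (integrable_conj_mul f f)
    (hasSum_translates hw0)).mul_left ((|B.det|⁻¹ : ℝ) : ℂ)
  have hfibR : ∀ n, HasSum (a n) (∑' m, a n m) := fun n =>
    (Complex.summable_ofReal.1 (hfib n).summable).hasSum
  have houter : HasSum (fun n => ((∑' m, a n m : ℝ) : ℂ)) (((|B.det|⁻¹ : ℝ) : ℂ) *
      ∫ x, (∑ r ∈ intBox d N, w (WithLp.toLp 2 (fun j => Int.fract (x j)) +
        WithLp.toLp 2 fun j => (r j : ℝ))) * (conj (f x) * f x)) := by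
    refine htot.congr_fun fun n => ?_
    rw [Complex.ofReal_tsum]
    exact (hfib n).tsum_eq
  have hprod : Summable fun q : (Fin d → ℤ) × (Fin d → ℤ) => a q.1 q.2 := by
    rw [summable_prod_of_nonneg fun q => sq_nonneg _]
    exact ⟨fun n => (hfibR n).summable, Complex.summable_ofReal.1 houter.summable⟩
  have hswap : (fun p : (Fin d → ℤ) × (Fin d → ℤ) =>
      ‖inner ℂ (memLp_gaborSystem (B := B) hg g0 p).toLp f‖ ^ 2)
      = (fun q : (Fin d → ℤ) × (Fin d → ℤ) => a q.1 q.2) ∘ Equiv.prodComm _ _ := rfl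
  rw [hswap, (Equiv.prodComm _ _).summable_iff]
  refine ⟨hprod, ?_⟩
  refine (((Equiv.prodComm _ _).tsum_eq fun q : (Fin d → ℤ) × (Fin d → ℤ) =>
    a q.1 q.2).trans hprod.tsum_prod).trans_le ?_
  have hval := houter.tsum_eq
  rw [← Complex.ofReal_tsum] at hval
  have hle := (Complex.re_le_norm _).trans (congrArg norm hval).le
  rw [Complex.ofReal_re, norm_mul] at hle
  have hff : ∫ x, ‖conj (f x) * f x‖ = ‖f‖ ^ 2 := by
    have h1 := integral_conj_mul f f
    rw [inner_self_eq_norm_sq_to_K] at h1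
    have h2 : ∀ x, conj (f x) * f x = ((‖conj (f x) * f x‖ : ℝ) : ℂ) := fun x => by
      rw [norm_mul, RCLike.norm_conj, ← Complex.normSq_eq_conj_mul_self,
        Complex.normSq_eq_norm_sq, sq]
    rw [integral_congr_ae (Filter.Eventually.of_forall h2), integral_complex_ofReal] at h1
    refine Complex.ofReal_injective (h1.trans ?_)
    simp
  have hint : ‖∫ x, (∑ r ∈ intBox d N, w (WithLp.toLp 2 (fun j => Int.fract (x j)) +
        WithLp.toLp 2 fun j => (r j : ℝ))) * (conj (f x) * f x)‖
      ≤ (intBox d N).card * (C * C) * ‖f‖ ^ 2 := by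
    rw [← hff, ← integral_const_mul]
    refine norm_integral_le_of_norm_le ((integrable_conj_mul f f).norm.const_mul _)
      (Filter.Eventually.of_forall fun x => ?_)
    rw [norm_mul]
    refine mul_le_mul_of_nonneg_right ?_ (norm_nonneg _)
    refine (norm_sum_le _ _).trans ?_
    refine (Finset.sum_le_card_nsmul _ _ (C * C) fun r _ => hwC _).trans ?_
    rw [nsmul_eq_mul]
  calc _ ≤ _ := hle
    _ ≤ |B.det|⁻¹ * ((intBox d N).card * (C * C) * ‖f‖ ^ 2) := by
        rw [Complex.norm_real, Real.norm_of_nonneg (by positivity)]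
        gcongr
    _ = b₀ * ‖f‖ ^ 2 := by rw [hb₀]; ring
    _ ≤ _ := by
        have : 0 ≤ ‖f‖ ^ 2 := by positivity
        linarith

/-- Continuous windows living on `[0,N)^d` generate dual Gabor frames when the lattice
`(Bᵀ)⁻¹ ℤ^d` packs the cube and the windows satisfy the duality condition. -/
theorem generateDualGaborFrames_of_packing (hB : IsUnit B)
    (hBsharp : ∀ n : Fin d → ℤ, n ≠ 0 →
      ¬ ∀ j, (B.transpose⁻¹).mulVec (intVec n) j ∈ Set.Ioo (-(N : ℝ)) (N : ℝ))
    (hg : Continuous g) (g0 : ∀ x ∉ halfOpenCube d N, g x = 0)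
    (hh : Continuous h) (h0 : ∀ x ∉ halfOpenCube d N, h x = 0)
    (hdual : ∀ x, HasSum (fun n : Fin d → ℤ => conj (g (x - WithLp.toLp 2 (intVec n))) *
      h (x - WithLp.toLp 2 (intVec n))) ((|B.det| : ℝ) : ℂ)) :
    GenerateDualGaborFrames B g h := by
  have hdet : B.det ≠ 0 := ((Matrix.isUnit_iff_isUnit_det B).1 hB).ne_zero
  have hd : ((|B.det| : ℝ) : ℂ) ≠ 0 := by exact_mod_cast abs_ne_zero.2 hdet
  obtain ⟨b, hb, hbes⟩ := exists_bessel_gaborSystem hB hBsharp hg g0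
  obtain ⟨b', hb', hbes'⟩ := exists_bessel_gaborSystem hB hBsharp hh h0
  obtain ⟨C, hC⟩ := (hasCompactSupport_of_halfOpenCube g0).exists_bound_of_continuous hg
  obtain ⟨D, hD⟩ := (hasCompactSupport_of_halfOpenCube h0).exists_bound_of_continuous hh
  refine ⟨memLp_gaborSystem hg g0, memLp_gaborSystem hh h0,
    isDualFramePair_of_bessel hb hb' hbes hbes' fun f u => ?_⟩
  -- The two Bessel bounds give absolute summability over all pairs, so the sum may be evaluated
  -- iteratively, over `m` first and then over `n`.
  have hsum : Summable fun p => inner ℂ u (memLp_gaborSystem (B := B) hh h0 p).toLp *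
      inner ℂ (memLp_gaborSystem (B := B) hg g0 p).toLp f := by
    refine Summable.of_norm_bounded ((hbes' u).1.add (hbes f).1) fun p => ?_
    rw [norm_mul, norm_inner_symm]
    nlinarith [sq_nonneg (‖inner ℂ (memLp_gaborSystem (B := B) hh h0 p).toLp u‖ -
      ‖inner ℂ (memLp_gaborSystem (B := B) hg g0 p).toLp f‖),
      sq_nonneg (‖inner ℂ (memLp_gaborSystem (B := B) hh h0 p).toLp u‖),
      sq_nonneg (‖inner ℂ (memLp_gaborSystem (B := B) hg g0 p).toLp f‖)]
  have hswap := ((Equiv.prodComm _ _).hasSum_iff.2 hsum.hasSum).prod_fiberwise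
    fun n => hasSum_inner_gaborSystem hB hBsharp hg g0 hh h0 f u n
  have htot := (hasSum_integral_translates (C := C * D) (N := N)
    (w := fun x => conj (g x) * h x)
    ((Complex.continuous_conj.comp hg).mul hh) (fun x => by
      rw [norm_mul, RCLike.norm_conj]
      exact mul_le_mul (hC x) (hD x) (norm_nonneg _) ((norm_nonneg _).trans (hC x)))
    (fun x hx => by simp [g0 x hx]) (integrable_conj_mul f u) hdual).mul_left
    ((|B.det|⁻¹ : ℝ) : ℂ)
  have e : ((|B.det|⁻¹ : ℝ) : ℂ) * ∫ x, ((|B.det| : ℝ) : ℂ) * (conj (u x) * f x)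
      = inner ℂ u f := by
    rw [integral_const_mul, integral_conj_mul, ← mul_assoc, Complex.ofReal_inv,
      inv_mul_cancel₀ hd, one_mul]
  rw [e] at htot
  rw [← hswap.unique htot]
  exact hsum.hasSum

end Gabor

/-! ### The duality condition for the sine windows. -/

section SineWindow

open scoped ComplexConjugate

/-- The sine vanishes on the faces `x j = N`, so the closed cube may be replaced by the half-open
one. The closed cube would not do for packing: its points may differ by exactly `N` in a coordinate,
which the condition on `B^♯` allows. -/
theorem sinWindow_eq_zero {d M N : ℕ} (hM : 1 ≤ M) (hN : 1 ≤ N)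
    (G : EuclideanSpace ℝ (Fin d) → ℝ) (x : EuclideanSpace ℝ (Fin d))
    (hx : x ∉ halfOpenCube d N) : sinWindow M N G x = 0 := by
  have hN' : (N : ℝ) ≠ 0 := by exact_mod_cast (by omega : N ≠ 0)
  obtain ⟨j, hj⟩ : ∃ j, x j ∉ Set.Ico (0 : ℝ) N := by
    simpa only [halfOpenCube, Set.mem_ofPred_eq, not_forall] using hx
  rw [sinWindow_eq_prod, Finset.prod_eq_zero (Finset.mem_univ j)]
  · simp
  · by_cases h : x j ∈ Set.Icc (0 : ℝ) N
    · have hxN : x j = N := by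
        by_contra hne
        exact hj ⟨h.1, lt_of_le_of_ne h.2 hne⟩
      rw [Set.indicator_of_mem h, hxN, mul_div_assoc, div_self hN', mul_one, Real.sin_pi,
        zero_pow (by omega)]
    · exact Set.indicator_of_notMem h _

/-- On the cube the two factors `sin^M` combine to `sin^(2M)`, so the product of the windows is `P`
there and the partition of unity applies. -/
theorem hasSum_sinWindow_mul {d K N M : ℕ} (hN : 1 ≤ N) (hM : 1 ≤ M)
    {c : (Fin d → ℤ) → ℂ} {P G H : EuclideanSpace ℝ (Fin d) → ℝ}
    (hP : ∀ x, (P x : ℂ) = trigPoly N (freqBox d K) c x)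
    (hc : ∀ k ∈ freqBox d K, (∀ j, (N : ℤ) ∣ k j) →
      c k = if k = 0 then 1 / (N : ℂ) ^ d else 0)
    (hfact : ∀ x, P x = (∏ j, Real.sin (Real.pi * x j / N) ^ (2 * M)) * G x * H x)
    (x : EuclideanSpace ℝ (Fin d)) :
    HasSum (fun n : Fin d → ℤ => conj (sinWindow M N G (x - WithLp.toLp 2 (intVec n))) *
      sinWindow M N H (x - WithLp.toLp 2 (intVec n))) 1 := by
  have h := hasSum_translates (N := N)
    (w := fun x => conj (sinWindow M N G x) * sinWindow M N H x)
    (fun x hx => by simp [sinWindow_eq_zero hM hN G x hx]) x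
  convert h using 1
  rw [← Complex.ofReal_one, ← sum_intBox_eq_one hN hP hc
    (WithLp.toLp 2 fun j => Int.fract (x j)), Complex.ofReal_sum]
  refine Finset.sum_congr rfl fun r hr => ?_
  have hmem := halfOpenCube_subset_cube (add_mem_halfOpenCube x hr)
  rw [sinWindow, Set.indicator_of_mem hmem, sinWindow, Set.indicator_of_mem hmem,
    Complex.conj_ofReal, ← Complex.ofReal_mul, hfact]
  congr 1
  simp only [pow_mul', sq, Finset.prod_mul_distrib]
  ring

end SineWindow

theorem theorem4p1 (d K N M : ℕ) (hd : 1 ≤ d) (hN : 1 ≤ N) (hM : 1 ≤ M) (hMK : M ≤ K)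
    (c : (Fin d → ℤ) → ℂ) (P G H : EuclideanSpace ℝ (Fin d) → ℝ)
    (hP : ∀ x, (P x : ℂ) = trigPoly N (freqBox d K) c x)
    (hc : ∀ k ∈ freqBox d K, (∀ j, (N : ℤ) ∣ k j) →
      c k = if k = 0 then 1 / (N : ℂ) ^ d else 0)
    (hPsmooth : ContDiff ℝ ((2 * M - 1 : ℕ) : ℕ∞) ((cube d N).indicator P))
    (hG : IsRealTrigPoly N G) (hH : IsRealTrigPoly N H)
    (hfact : ∀ x, P x = (∏ j, Real.sin (Real.pi * x j / N) ^ (2 * M)) * G x * H x)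
    (B : Matrix (Fin d) (Fin d) ℝ) (hB : IsUnit B)
    (hBsharp : ∀ n : Fin d → ℤ, n ≠ 0 →
      ¬ ∀ j, (B.transpose⁻¹).mulVec (intVec n) j ∈ Set.Ioo (-(N : ℝ)) (N : ℝ)) :
    ContDiff ℝ ((M - 1 : ℕ) : ℕ∞) (sinWindow M N G) ∧
    ContDiff ℝ ((M - 1 : ℕ) : ℕ∞) (fun x => ((|B.det| : ℝ) : ℂ) * sinWindow M N H x) ∧
    GenerateDualGaborFrames B (sinWindow M N G)
      (fun x => ((|B.det| : ℝ) : ℂ) * sinWindow M N H x) := by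
  have hg := contDiff_sinWindow hM hN hG
  have hh : ContDiff ℝ ((M - 1 : ℕ) : ℕ∞) fun x => ((|B.det| : ℝ) : ℂ) * sinWindow M N H x :=
    contDiff_const.mul (contDiff_sinWindow hM hN hH)
  refine ⟨hg, hh, generateDualGaborFrames_of_packing hB hBsharp hg.continuous
    (sinWindow_eq_zero hM hN G) hh.continuous
    (fun x hx => by rw [sinWindow_eq_zero hM hN H x hx, mul_zero]) fun x => ?_⟩
  -- The factor `|det B|` in the second window cancels the inverse determinant from Parseval.
  have h := (hasSum_sinWindow_mul hN hM hP hc hfact x).mul_left ((|B.det| : ℝ) : ℂ)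
  rw [mul_one] at h
  refine h.congr_fun fun n => ?_
  ring
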